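/- Let $f:\mathbb R^n\to\mathbb R$ ($n\ge 1$) be an $L_p$-nested function: there is a finite rooted tree with ordered children whose $n$ leaves correspond to the coordinates of $x\in\mathbb R^n$ (in any order) and whose inner nodes $I$ (forming a set $\mathcal I$) have $\ell_I\ge 1$ children $(I,1),\dots,(I,\ell_I)$ and carry exponents $p_I>0$. The value of a leaf is $f_I(x_I)=|x_i|$ for the corresponding coordinate $x_i$, the value of an inner node is $f_I(x_I)=\bigl(\sum_{k=1}^{\ell_I} f_{I,k}(x_{I,k})^{p_I}\bigr)^{1/p_I}$, where $x_I$ collects the coordinates at the leaves below $I$, and $f=f_\emptyset$ is the value at the root. Set $p_I=1$ if $I$ is a leaf, and let $n_I$ be the number of leaves of the subtree under $I$. Let $\mathcal L$ be the set of nodes on the path from the root to the leaf of $x_n$, the root excluded. For $u\in\mathbb R^{n-1}$ put $g_\emptyset=1$ and, for $(I,i)\in\mathcal L$ with parent $I$, $$g_{I,i}=\Bigl(g_I^{\,p_I}-\sum_{j\ne i} f_{I,j}(u_{I,j})^{p_I}\Bigr)^{1/p_I},\qquad G_{I,i}=g_{I,i}^{\,p_{I,i}-p_I}.$$ Let $\mathbb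 L_f=\{x\in\mathbb R^n: f(x)=1\}$, let the uniform distribution on $\mathbb L_f$ be the law of $x/f(x)$ for $x$ uniformly distributed on $\{f\le 1\}$, let $\mathcal S_f(1)$ be the derivative at $R=1$ of the Lebesgue measure of $\{x:f(x)\le R\}$, and let $B[a,b]=\Gamma(a)\Gamma(b)/\Gamma(a+b)$. Then the uniform distribution is a probability measure carried by $\mathbb L_f$, and the first $n-1$ coordinates $u_1,\dots,u_{n-1}$ have under it, with respect to Lebesgue measure on $\mathbb R^{n-1}$, the density $$\rho(u_1,\dots,u_{n-1})=\frac{\prod_{L\in\mathcal L}G_L}{2^{n-1}}\prod_{I\in\mathcal I}\left(p_I^{\ell_I-1}\prod_{k=1}^{\ell_I-1}B\left[\frac{\sum_{i=1}^{k}n_{I,i}}{p_I},\frac{n_{I,k+1}}{p_I}\right]^{-1}\right)$$ if $f(u_1,\dots,u_{n-1},0)<1$, and $\rho=0$ otherwise; each of the half-shells $\{u_n>0\}$ and $\{u_n<0\}$ contributes $\rho/2$. Moreover, for every measurable probability density $\varrho$ on $(0,\infty)$, $\varrho(f(x))/(f(x)^{n-1}\mathcal S_f(1))$ is a probability density on $\mathbb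 R^n$; if $x$ has this density, then $r=f(x)$ and $u=x/f(x)$ are independent, $r$ has density $\varrho$, $u$ is uniformly distributed on $\mathbb L_f$, and $(u_1,\dots,u_{n-1})$ has density $\rho$. -/

import Mathlib

noncomputable section

/-- Ordered rooted trees defining `L_p`-nested functions.  Every inner node has `m + 1 ≥ 1` ordered
children and carries a positive exponent `p`. -/
inductive LpTree : Type
  | leaf : LpTree
  | node (m : ℕ) (p : ℝ) (hp : 0 < p) (child : Fin (m + 1) → LpTree) : LpTree

namespace LpTree

/-- The type of leaves of a tree: a leaf of an inner node is a leaf of one of its children. -/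
def Leaf : LpTree → Type
  | leaf => Unit
  | node m _ _ c => (i : Fin (m + 1)) × (c i).Leaf

/-- The number `n_I` of leaves of a (sub)tree. -/
def numLeaves : LpTree → ℕ
  | leaf => 1
  | node _ _ _ c => ∑ i, (c i).numLeaves

/-- The exponent `p_I` at the root of a (sub)tree, with the convention `p = 1` at a leaf. -/
def exponent : LpTree → ℝ
  | leaf => 1
  | node _ p _ _ => p

/-- The value `v_I = f_I(x_I)` of a (sub)tree: `|x|` at a leaf, and the `L_p`-norm of the values of
the children at an inner node.  Coefficients are indexed by the leaves. -/
def value : (T : LpTree) → (T.Leaf → ℝ) → ℝ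
  | leaf, x => |x ()|
  | node _ p _ c, x => (∑ i, ((c i).value fun l => x ⟨i, l⟩) ^ p) ^ (1 / p)

/-- Let `I` be a node whose value is prescribed to be `g`.  Then the value of its child `i` is
determined by the values of the other children:
`(g ^ p_I - ∑_{j ≠ i} f_{I,j}(x_{I,j}) ^ p_I) ^ (1 / p_I)`. -/
def solveChild {m : ℕ} (p : ℝ) (c : Fin (m + 1) → LpTree) (i : Fin (m + 1))
    (x : ((j : Fin (m + 1)) × (c j).Leaf) → ℝ) (g : ℝ) : ℝ :=
  (g ^ p - ∑ j with j ≠ i, ((c j).value fun l => x ⟨j, l⟩) ^ p) ^ (1 / p)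

/-- The product of the terms `G_L = g_L ^ (p_L - p_I)` (`I` the parent of `L`) over all nodes `L` on
the path from the root of the tree to a given leaf, the root itself excluded, when the value of the
root is prescribed to be `g`.  The coefficient of `x` at the given leaf is not used. -/
def prodG : (T : LpTree) → T.Leaf → (T.Leaf → ℝ) → ℝ → ℝ
  | leaf, _, _, _ => 1
  | node _ p _ c, ⟨i, l⟩, x, g =>
      solveChild p c i x g ^ ((c i).exponent - p) *
        (c i).prodG l (fun l' => x ⟨i, l'⟩) (solveChild p c i x g)

/-- The product over all inner nodes `I` of
`p_I ^ (ℓ_I - 1) * ∏_{k = 1}^{ℓ_I - 1} B[(∑_{i = 1}^k n_{I,i}) / p_I, n_{I,k+1} / p_I]⁻¹`.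
Here `B` is the beta function `B[a, b] = Γ(a) Γ(b) / Γ(a + b)`. -/
def betaFactor : LpTree → ℝ
  | leaf => 1
  | node m p _ c =>
      (p ^ m * ∏ k : Fin m,
        (ProbabilityTheory.beta ((∑ i ∈ Finset.Iic k.castSucc, ((c i).numLeaves : ℝ)) / p)
          (((c k.succ).numLeaves : ℝ) / p))⁻¹) *
      ∏ i, (c i).betaFactor

variable (T : LpTree) {n : ℕ} (e : T.Leaf ≃ Fin (n + 1))

/-- The `L_p`-nested function `f` on `ℝ ^ (n + 1)` given by a tree whose leaves are matched with the
coordinates by `e`. -/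
def nested (x : Fin (n + 1) → ℝ) : ℝ := T.value fun l => x (e l)

/-- The unit `L_p`-nested sphere. -/
def unitSphere : Set (Fin (n + 1) → ℝ) := {x | T.nested e x = 1}

/-- The normalized vector `u = x / f(x)`. -/
def normalize (x : Fin (n + 1) → ℝ) : Fin (n + 1) → ℝ := fun i => x i / T.nested e x

/-- The volume of the `L_p`-nested ball of radius `R`. -/
def ballVolume (R : ℝ) : ℝ := (MeasureTheory.volume {x | T.nested e x ≤ R}).toReal

/-- The surface `S_f(R)` of the `L_p`-nested sphere of radius `R`: the derivative of the volume of
the ball with respect to the radius. -/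
def surface (R : ℝ) : ℝ := deriv (T.ballVolume e) R

/-- The `L_p`-nested symmetric distribution with radial density `ϱ`: the measure on `ℝ ^ (n + 1)`
with density `ϱ(f(x)) / (f(x) ^ n * S_f(1))`. -/
def symmetricDistribution (ϱ : ℝ → ℝ) : MeasureTheory.Measure (Fin (n + 1) → ℝ) :=
  MeasureTheory.volume.withDensity fun x =>
    ENNReal.ofReal (ϱ (T.nested e x) / (T.nested e x ^ n * T.surface e 1))

/-- The uniform distribution on the unit `L_p`-nested sphere: the law of `x / f(x)` for `x` uniformly
distributed in the unit `L_p`-nested ball. -/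
def uniformDistribution : MeasureTheory.Measure (Fin (n + 1) → ℝ) :=
  (ProbabilityTheory.cond MeasureTheory.volume {x | T.nested e x ≤ 1}).map (T.normalize e)

open Classical in
/-- The density over the first `n` coordinates of the normalized vector.  It is supported on the
`(u_1, …, u_n)` that can be completed to a point of the sphere with nonzero last coordinate. -/
def uniformDensity (u : Fin n → ℝ) : ℝ :=
  if T.nested e (Fin.snoc u 0) < 1 then
    T.prodG (e.symm (Fin.last n))
        (fun l => (Fin.snoc u 0 : Fin (n + 1) → ℝ) (e l)) 1 / 2 ^ n * T.betaFactor
  else 0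

end LpTree

end

/-! The nested function f is positively homogeneous of degree 1 and dominates every |x i|.
Homogeneity gives polar coordinates: x ↦ (f x, x / f x) carries Lebesgue measure to the product of
the measure with density N r^(N-1) and a cone measure on the unit sphere (`IsGauge.map_polar`). A
density that depends on f alone therefore makes radius and direction independent, and the direction
has the normalized cone measure as its law (`map_symmetricDistribution`).

To project the cone measure, fix the leading coordinates y and substitute r = f(y, t) for the last
coordinate t > 0. By the chain rule along the path to the last leaf, ∂f/∂t is a product of powers of
the node values; regrouped node by node, it is on the unit sphere the reciprocal of the product of
the G_L (`exists_hasDerivAt_value`). The further substitution y = r u contributes r^n and separates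
r from u (`lintegral_halfSpace`), so the half-shell has density ∏ G_L up to a constant. A reflection
gives the other half, and the hyperplane between them is null.

The constant comes from N times the volume of the unit ball. For p the root exponent, f^p is a sum
over the children, so the integral of exp(-f^p) factorizes; in polar coordinates each integral is N
· vol · Γ(N/p) / p. Induction on the tree yields `numLeaves_mul_volume`, where the Beta functions
are a telescoped quotient of Gammas (`prod_beta_eq`). -/

noncomputable section

open MeasureTheory Set Filter Topology
open scoped ENNReal Pointwise

/-! ### Values of trees and their derivative at one leaf -/

namespace LpTree

instance instFintypeLeaf : (T : LpTree) → Fintype T.Leaf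
  | leaf => inferInstanceAs (Fintype Unit)
  | node m _ _ c =>
    letI := fun i => instFintypeLeaf (c i)
    inferInstanceAs (Fintype ((i : Fin (m + 1)) × (c i).Leaf))

lemma card_leaf (T : LpTree) : Fintype.card T.Leaf = T.numLeaves := by
  induction T with
  | leaf => rfl
  | node m p hp c ih =>
    simp only [numLeaves, ← ih]
    exact Fintype.card_sigma

lemma numLeaves_pos (T : LpTree) : 0 < T.numLeaves := by
  induction T with
  | leaf => exact one_pos
  | node m p hp c ih => exact Finset.sum_pos (fun i _ => ih i) Finset.univ_nonempty

lemma value_node {m : ℕ} {p : ℝ} (hp : 0 < p) (c : Fin (m + 1) → LpTree)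
    (x : (node m p hp c).Leaf → ℝ) :
    (node m p hp c).value x = (∑ i, ((c i).value fun l => x ⟨i, l⟩) ^ p) ^ (1 / p) := rfl

lemma value_nonneg (T : LpTree) (x : T.Leaf → ℝ) : 0 ≤ T.value x := by
  induction T with
  | leaf => exact abs_nonneg _
  | node m p hp c ih =>
    rw [value_node]
    exact Real.rpow_nonneg (Finset.sum_nonneg fun i _ => Real.rpow_nonneg (ih i _) _) _

lemma value_node_rpow {m : ℕ} {p : ℝ} (hp : 0 < p) (c : Fin (m + 1) → LpTree)
    (x : (node m p hp c).Leaf → ℝ) :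
    (node m p hp c).value x ^ p = ∑ i, ((c i).value fun l => x ⟨i, l⟩) ^ p := by
  rw [value_node, one_div, Real.rpow_inv_rpow _ hp.ne']
  exact Finset.sum_nonneg fun i _ => Real.rpow_nonneg (value_nonneg _ _) _

lemma continuous_value (T : LpTree) : Continuous T.value := by
  induction T with
  | leaf => exact (continuous_apply ()).abs
  | node m p hp c ih =>
    refine Continuous.rpow_const ?_ fun _ => Or.inr (one_div_pos.2 hp).le
    refine continuous_finsetSum _ fun i _ => Continuous.rpow_const ?_ fun _ => Or.inr hp.le
    exact (ih i).comp (continuous_pi fun l => continuous_apply _)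

lemma measurable_value (T : LpTree) : Measurable T.value := T.continuous_value.measurable

lemma value_const_mul (T : LpTree) {a : ℝ} (ha : 0 ≤ a) (x : T.Leaf → ℝ) :
    (T.value fun l => a * x l) = a * T.value x := by
  induction T with
  | leaf => simp [value, abs_mul, abs_of_nonneg ha]
  | node m p hp c ih =>
    rw [value_node, value_node]
    simp only [ih]
    rw [Finset.sum_congr rfl fun i _ => Real.mul_rpow ha (value_nonneg (c i) _),
      ← Finset.mul_sum, Real.mul_rpow (Real.rpow_nonneg ha _)
        (Finset.sum_nonneg fun i _ => Real.rpow_nonneg (value_nonneg _ _) _),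
      one_div, Real.rpow_rpow_inv ha hp.ne']

lemma value_child_le {m : ℕ} {p : ℝ} (hp : 0 < p) (c : Fin (m + 1) → LpTree)
    (x : (node m p hp c).Leaf → ℝ) (i : Fin (m + 1)) :
    ((c i).value fun l => x ⟨i, l⟩) ≤ (node m p hp c).value x := by
  rw [← Real.rpow_le_rpow_iff (value_nonneg _ _) (value_nonneg _ _) hp, value_node_rpow]
  exact Finset.single_le_sum
    (f := fun i => ((c i).value fun l => x ⟨i, l⟩) ^ p)
    (fun j _ => Real.rpow_nonneg (value_nonneg _ _) _) (Finset.mem_univ i)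

lemma abs_le_value (T : LpTree) (x : T.Leaf → ℝ) (l : T.Leaf) : |x l| ≤ T.value x := by
  induction T with
  | leaf => exact le_rfl
  | node m p hp c ih =>
    obtain ⟨i, l⟩ := l
    exact (ih i (fun l => x ⟨i, l⟩) l).trans (value_child_le hp c x i)

lemma value_congr_abs (T : LpTree) {x y : T.Leaf → ℝ} (h : ∀ l, |x l| = |y l|) :
    T.value x = T.value y := by
  induction T with
  | leaf => exact h ()
  | node m p hp c ih =>
    rw [value_node, value_node]
    congr 1
    exact Finset.sum_congr rfl fun i _ => by rw [ih i fun l => h ⟨i, l⟩]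

lemma measurable_solveChild {m : ℕ} (p : ℝ) (c : Fin (m + 1) → LpTree) (i : Fin (m + 1)) :
    Measurable fun q : (((j : Fin (m + 1)) × (c j).Leaf) → ℝ) × ℝ =>
      solveChild p c i q.1 q.2 := by
  refine Measurable.pow_const ?_ _
  refine (measurable_snd.pow_const _).sub (Finset.measurable_sum _ fun j _ => ?_)
  refine Measurable.pow_const ((c j).measurable_value.comp ?_) _
  exact measurable_pi_lambda _ fun l => (measurable_pi_apply _).comp measurable_fst

lemma measurable_prodG (T : LpTree) (l : T.Leaf) :
    Measurable fun q : (T.Leaf → ℝ) × ℝ => T.prodG l q.1 q.2 := by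
  induction T with
  | leaf => exact measurable_const
  | node m p hp c ih =>
    obtain ⟨i, l⟩ := l
    refine ((measurable_solveChild p c i).pow_const _).mul ?_
    refine (ih i l).comp (Measurable.prodMk ?_ (measurable_solveChild p c i))
    exact measurable_pi_lambda _ fun l => (measurable_pi_apply _).comp measurable_fst

/-- The p-th power of a node's value is the sum over its children, so subtracting the siblings
leaves child i. Thus the recursion for g_I recovers the true node values without reading anything
below child i. -/
lemma solveChild_value {m : ℕ} {p : ℝ} (hp : 0 < p) (c : Fin (m + 1) → LpTree) (i : Fin (m + 1))
    (x y : (node m p hp c).Leaf → ℝ)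
    (h : ∀ j ≠ i, ∀ l, x ⟨j, l⟩ = y ⟨j, l⟩) :
    solveChild p c i x ((node m p hp c).value y) = (c i).value fun l => y ⟨i, l⟩ := by
  have hx : ∑ j with j ≠ i, ((c j).value fun l => x ⟨j, l⟩) ^ p =
      ∑ j with j ≠ i, ((c j).value fun l => y ⟨j, l⟩) ^ p :=
    Finset.sum_congr rfl fun j hj => by
      simp only [Finset.mem_filter, Finset.mem_univ, true_and] at hj
      simp only [h j hj]
  change ((node m p hp c).value y ^ p - ∑ j with j ≠ i, ((c j).value fun l => x ⟨j, l⟩) ^ p) ^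
    (1 / p) = _
  rw [value_node_rpow, hx, Finset.filter_ne', ← Finset.add_sum_erase _ _
    (Finset.mem_univ i), add_sub_cancel_right, one_div, Real.rpow_rpow_inv (value_nonneg _ _) hp.ne']

/-- Along a curve that moves only the coefficient at the leaf `l`, with unit speed, the derivative
of the value of the tree is the inverse of `prodG`, up to a power of the value. -/
lemma exists_hasDerivAt_value (T : LpTree) (l : T.Leaf) (x : T.Leaf → ℝ) (X : ℝ → T.Leaf → ℝ)
    (hl : ∀ t, X t l = t) (hX : ∀ t, ∀ l' ≠ l, X t l' = x l') {t : ℝ} (ht : 0 < t) :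
    ∃ D : ℝ, 0 < D ∧ HasDerivAt (fun s => T.value (X s)) D t ∧
      D * T.prodG l x (T.value (X t)) = T.value (X t) ^ (1 - T.exponent) := by
  induction T with
  | leaf =>
    refine ⟨1, one_pos, ?_, by simp [prodG, exponent]⟩
    have h : (fun s => leaf.value (X s)) = fun s => |s| := by
      funext s
      exact congrArg abs (hl s)
    rw [h]
    exact hasDerivAt_abs_pos ht
  | node m p hp c ih =>
    obtain ⟨i, l⟩ := l
    obtain ⟨D, hD, hder, hprod⟩ := ih i l (fun l' => x ⟨i, l'⟩) (fun s l' => X s ⟨i, l'⟩) hl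
      (fun s l' hl' => hX s ⟨i, l'⟩ (by
        intro h
        exact hl' (eq_of_heq (Sigma.mk.inj h).2)))
    have hne : ∀ s, ∀ j ≠ i, ∀ l' : (c j).Leaf, x ⟨j, l'⟩ = X s ⟨j, l'⟩ := fun s j hj l' =>
      (hX s ⟨j, l'⟩ (by
        intro h
        exact hj (Sigma.mk.inj h).1)).symm
    set v : ℝ → ℝ := fun s => (c i).value fun l' => X s ⟨i, l'⟩ with hv
    -- Positivity of the child's value makes the real powers differentiable for every p > 0,
    -- including p < 1.
    have hvt : 0 < v t := by
      refine lt_of_lt_of_le ?_ (abs_le_value (c i) _ l)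
      rw [hl]
      exact abs_pos.2 ht.ne'
    set w : ℝ := ∑ j ∈ Finset.univ.erase i, ((c j).value fun l' => x ⟨j, l'⟩) ^ p with hw
    have hw0 : 0 ≤ w := Finset.sum_nonneg fun j _ => Real.rpow_nonneg (value_nonneg _ _) _
    have hval : ∀ s, (node m p hp c).value (X s) = (v s ^ p + w) ^ (1 / p) := by
      intro s
      rw [value_node, ← Finset.add_sum_erase _ _ (Finset.mem_univ i)]
      congr 2
      refine Finset.sum_congr rfl fun j hj => ?_
      simp only [hne s j (Finset.ne_of_mem_erase hj)]
    have hbase : 0 < v t ^ p + w := add_pos_of_pos_of_nonneg (Real.rpow_pos_of_pos hvt p) hw0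
    set F : ℝ := (node m p hp c).value (X t) with hF
    have hFpos : 0 < F := by
      rw [hF, hval]
      exact Real.rpow_pos_of_pos hbase _
    have hFp : (v t ^ p + w) ^ (1 / p - 1) = F ^ (1 - p) := by
      rw [hF, hval, ← Real.rpow_mul hbase.le]
      congr 1
      field_simp
    refine ⟨F ^ (1 - p) * (v t ^ (p - 1) * D), by positivity, ?_, ?_⟩
    · have h1 : HasDerivAt (fun s => v s ^ p + w) (D * p * v t ^ (p - 1)) t :=
        (hder.rpow_const (Or.inl hvt.ne')).add_const w
      have h2 := h1.rpow_const (p := 1 / p) (Or.inl hbase.ne')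
      rw [hFp] at h2
      refine (h2.congr_deriv ?_).congr_of_eventuallyEq (Eventually.of_forall hval)
      field_simp
    · have hsolve : solveChild p c i x F = v t := by
        rw [hF]
        exact solveChild_value hp c i x (X t) (hne t)
      have hG : (node m p hp c).prodG ⟨i, l⟩ x F =
          v t ^ ((c i).exponent - p) * (c i).prodG l (fun l' => x ⟨i, l'⟩) (v t) := by
        rw [← hsolve]
        rfl
      rw [hG]
      have hexp : (node m p hp c).exponent = p := rfl
      rw [hexp]
      -- With q the child's exponent, the powers of `v t` are p - 1 from the chain rule, q - p from
      -- G and 1 - q from the induction hypothesis; they sum to 0.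
      calc F ^ (1 - p) * (v t ^ (p - 1) * D) *
            (v t ^ ((c i).exponent - p) * (c i).prodG l (fun l' => x ⟨i, l'⟩) (v t))
          = F ^ (1 - p) * (v t ^ (p - 1) * v t ^ ((c i).exponent - p) *
            (D * (c i).prodG l (fun l' => x ⟨i, l'⟩) (v t))) := by ring
        _ = F ^ (1 - p) := by
          rw [hprod, ← Real.rpow_add hvt, ← Real.rpow_add hvt]
          ring_nf
          simp

end LpTree

/-! ### Polar coordinates for a gauge -/

/-- The radial part of Lebesgue measure in dimension `N`, normalized to be `R ^ N` on `(0, R]`. -/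
def radialMeasure (N : ℕ) : Measure ℝ :=
  (volume.restrict (Ioi 0)).withDensity fun r => ENNReal.ofReal (N * r ^ (N - 1))

lemma radialMeasure_Iic {N : ℕ} (hN : 0 < N) (R : ℝ) :
    radialMeasure N (Iic R) = ENNReal.ofReal (max R 0 ^ N) := by
  rw [radialMeasure, withDensity_apply _ measurableSet_Iic,
    Measure.restrict_restrict measurableSet_Iic, inter_comm, Ioi_inter_Iic]
  rcases le_or_gt R 0 with hR | hR
  · simp [hR, hN.ne']
  · rw [max_eq_left hR.le]
    rw [← ofReal_integral_eq_lintegral_ofReal, ← intervalIntegral.integral_of_le hR.le]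
    · congr 1
      rw [intervalIntegral.integral_const_mul, integral_pow]
      obtain ⟨k, rfl⟩ : ∃ k, N = k + 1 := ⟨N - 1, by omega⟩
      simp
      field_simp
    · exact (Continuous.integrableOn_Icc (by fun_prop)).mono_set Ioc_subset_Icc_self
    · filter_upwards [ae_restrict_mem measurableSet_Ioc] with r hr
      have := hr.1.le
      positivity

/-- The data of a gauge: a measurable function which is positively homogeneous and vanishes only at
the origin, and whose unit ball has finite volume. -/
structure IsGauge {ι : Type*} [Fintype ι] (F : (ι → ℝ) → ℝ) : Prop where
  measurable : Measurable F
  smul : ∀ a : ℝ, 0 < a → ∀ x, F (a • x) = a * F x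
  pos : ∀ x, x ≠ 0 → 0 < F x
  zero : F 0 = 0
  volume_lt_top : volume {x | F x ≤ 1} < ∞

namespace IsGauge

variable {ι : Type*} [Fintype ι] {F : (ι → ℝ) → ℝ} (hF : IsGauge F)

lemma measurable_normalize (hF : IsGauge F) : Measurable fun x => (F x)⁻¹ • x :=
  hF.measurable.inv.smul measurable_id

lemma ball_inter_eq_smul (hF : IsGauge F) (A : Set (ι → ℝ)) {R : ℝ} (hR : 0 < R) :
    {x | F x ≤ R ∧ (F x)⁻¹ • x ∈ A} = R • {x | F x ≤ 1 ∧ (F x)⁻¹ • x ∈ A} := by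
  ext x
  rw [mem_smul_set_iff_inv_smul_mem₀ hR.ne']
  simp only [mem_ofPred_eq, hF.smul _ (inv_pos.2 hR), smul_smul]
  rw [inv_mul_le_iff₀ hR, mul_one, mul_inv, inv_inv, mul_right_comm, mul_inv_cancel₀ hR.ne',
    one_mul]

/-- Dilation by R > 0 preserves directions and multiplies volume by R^N. For R ≤ 0 the set lies in
{0}, which is null in positive dimension. This is the product formula on the rectangles that
generate the σ-algebra in `map_polar`. -/
lemma volume_ball_inter [Nonempty ι] (hF : IsGauge F) (A : Set (ι → ℝ)) (R : ℝ) :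
    volume {x | F x ≤ R ∧ (F x)⁻¹ • x ∈ A} =
      radialMeasure (Fintype.card ι) (Iic R) * volume {x | F x ≤ 1 ∧ (F x)⁻¹ • x ∈ A} := by
  rw [radialMeasure_Iic Fintype.card_pos]
  rcases le_or_gt R 0 with hR | hR
  · have h0 : volume {x | F x ≤ R ∧ (F x)⁻¹ • x ∈ A} = 0 := by
      refine measure_mono_null (t := {0}) (fun x hx => ?_) (measure_singleton _)
      by_contra h
      exact absurd (hF.pos x h) (not_lt.2 (hx.1.trans hR))
    rw [h0, max_eq_right hR, zero_pow Fintype.card_ne_zero]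
    simp
  · rw [hF.ball_inter_eq_smul A hR, Measure.addHaar_smul, Module.finrank_fintype_fun_eq_card,
      max_eq_left hR.le, abs_of_nonneg (pow_nonneg hR.le _)]

/-- The unnormalized cone measure on the unit sphere of a gauge. -/
def coneMeasure (F : (ι → ℝ) → ℝ) : Measure (ι → ℝ) :=
  (volume.restrict {x | F x ≤ 1}).map fun x => (F x)⁻¹ • x

lemma coneMeasure_univ (hF : IsGauge F) : coneMeasure F univ = volume {x | F x ≤ 1} := by
  rw [coneMeasure, Measure.map_apply hF.measurable_normalize MeasurableSet.univ]
  simp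

lemma isFiniteMeasure_coneMeasure (hF : IsGauge F) : IsFiniteMeasure (coneMeasure F) :=
  ⟨by rw [hF.coneMeasure_univ]; exact hF.volume_lt_top⟩

/-- Polar coordinates for a gauge. -/
theorem map_polar [Nonempty ι] (hF : IsGauge F) :
    (volume : Measure (ι → ℝ)).map (fun x => (F x, (F x)⁻¹ • x)) =
      (radialMeasure (Fintype.card ι)).prod (coneMeasure F) := by
  have := hF.isFiniteMeasure_coneMeasure
  have hball : MeasurableSet {x | F x ≤ 1} := measurableSet_le hF.measurable measurable_const
  symm
  refine Measure.prod_eq_generateFrom (C := range Iic) (D := {s | MeasurableSet s})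
    (borel_eq_generateFrom_Iic ℝ ▸ BorelSpace.measurable_eq.symm)
    MeasurableSpace.generateFrom_measurableSet isPiSystem_Iic MeasurableSpace.isPiSystem_measurableSet
    ⟨fun k => Iic (k : ℝ), fun k => ⟨_, rfl⟩, fun k => ?_, ?_⟩
    (Measure.toFiniteSpanningSetsIn _) ?_
  · rw [radialMeasure_Iic Fintype.card_pos]
    exact ENNReal.ofReal_lt_top
  · refine eq_univ_of_forall fun r => mem_iUnion.2 ?_
    exact exists_nat_ge r
  · rintro _ ⟨R, rfl⟩ A hA
    rw [Measure.map_apply (hF.measurable.prodMk hF.measurable_normalize)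
      (measurableSet_Iic.prod hA), coneMeasure, Measure.map_apply hF.measurable_normalize hA,
      Measure.restrict_apply (hF.measurable_normalize hA)]
    refine (hF.volume_ball_inter A R).trans ?_
    congr 2
    ext x
    exact and_comm

theorem lintegral_polar [Nonempty ι] (hF : IsGauge F) {h : ℝ × (ι → ℝ) → ℝ≥0∞}
    (hh : Measurable h) :
    ∫⁻ x, h (F x, (F x)⁻¹ • x) =
      ∫⁻ q, h q ∂((radialMeasure (Fintype.card ι)).prod (coneMeasure F)) := by
  rw [← hF.map_polar, lintegral_map hh (hF.measurable.prodMk hF.measurable_normalize)]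

theorem lintegral_comp [Nonempty ι] (hF : IsGauge F) {h : ℝ → ℝ≥0∞} (hh : Measurable h) :
    ∫⁻ x, h (F x) = (∫⁻ r, h r ∂radialMeasure (Fintype.card ι)) * volume {x | F x ≤ 1} := by
  have := hF.isFiniteMeasure_coneMeasure
  have h1 := hF.lintegral_polar (h := fun q => h q.1) (hh.comp measurable_fst)
  have h2 := lintegral_prod_mul (μ := radialMeasure (Fintype.card ι)) (ν := coneMeasure F)
    (f := h) (g := fun _ => 1) hh.aemeasurable aemeasurable_const
  simp only [mul_one, lintegral_one, hF.coneMeasure_univ] at h2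
  exact h1.trans h2

/-- If the unit ball were null, the polar formula for the constant 1 would make all of Lebesgue
measure vanish. -/
lemma volume_ball_pos (hF : IsGauge F) [Nonempty ι] : 0 < volume {x | F x ≤ 1} := by
  rw [pos_iff_ne_zero]
  intro h
  have h1 := hF.lintegral_comp (h := fun _ => 1) measurable_const
  rw [h, mul_zero, lintegral_one] at h1
  exact NeZero.ne (volume : Measure (ι → ℝ)) (Measure.measure_univ_eq_zero.1 h1)

lemma volume_ball (hF : IsGauge F) [Nonempty ι] (R : ℝ) :
    volume {x | F x ≤ R} = ENNReal.ofReal (max R 0 ^ Fintype.card ι) * volume {x | F x ≤ 1} := by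
  have := hF.volume_ball_inter univ R
  rw [radialMeasure_Iic Fintype.card_pos] at this
  simpa using this

end IsGauge

/-! ### Product spaces, Beta products and exponential integrals -/

lemma measurePreserving_piCurry_symm {ι : Type*} [Fintype ι] {κ : ι → Type*}
    [∀ i, Fintype (κ i)] :
    MeasurePreserving (MeasurableEquiv.piCurry fun (i : ι) (_ : κ i) => ℝ).symm volume volume := by
  refine ⟨MeasurableEquiv.measurable _, (Measure.pi_eq fun s _ => ?_).symm⟩
  rw [MeasurableEquiv.map_apply]
  have h : (MeasurableEquiv.piCurry fun (i : ι) (_ : κ i) => ℝ).symm ⁻¹' (pi univ s) =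
      pi univ fun i => pi univ fun j => s ⟨i, j⟩ := by
    ext x
    simp only [mem_preimage, Set.mem_pi, mem_univ, true_implies]
    exact ⟨fun h i j => h ⟨i, j⟩, fun h q => h q.1 q.2⟩
  rw [h, volume_pi, Measure.pi_pi, Fintype.prod_sigma]
  exact Finset.prod_congr rfl fun i _ => by rw [volume_pi, Measure.pi_pi]

/-- Telescoping: the Gamma of each partial sum is the denominator of one factor and a numerator of
the next. -/
lemma prod_beta_eq {m : ℕ} (a : Fin (m + 1) → ℝ) (ha : ∀ i, 0 < a i) :
    ∏ k : Fin m, ProbabilityTheory.beta (∑ i ∈ Finset.Iic k.castSucc, a i) (a k.succ) =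
      (∏ i, Real.Gamma (a i)) / Real.Gamma (∑ i, a i) := by
  induction m with
  | zero => simp [(Real.Gamma_pos_of_pos (ha 0)).ne']
  | succ m ih =>
    have h := ih (fun i => a i.castSucc) fun i => ha _
    rw [Fin.prod_univ_castSucc]
    have hk : ∀ k : Fin m, ∑ i ∈ Finset.Iic k.castSucc.castSucc, a i =
        ∑ i ∈ Finset.Iic k.castSucc, a i.castSucc := fun k => Fin.sum_Iic_castSucc a k.castSucc
    have hlast : ∑ i ∈ Finset.Iic (Fin.last m).castSucc, a i = ∑ i : Fin (m + 1), a i.castSucc := by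
      rw [Fin.sum_Iic_castSucc, ← Fin.top_eq_last, Finset.Iic_top]
    simp only [hk, hlast, ← Fin.castSucc_succ]
    rw [h, Fin.succ_last, ProbabilityTheory.beta, Fin.prod_univ_castSucc (n := m + 1),
      Fin.sum_univ_castSucc (n := m + 1)]
    have := (Real.Gamma_pos_of_pos (Finset.sum_pos (fun (i : Fin (m + 1)) _ => ha i.castSucc)
      Finset.univ_nonempty)).ne'
    field_simp

lemma lintegral_radialMeasure (N : ℕ) {h : ℝ → ℝ≥0∞} (hh : Measurable h) :
    ∫⁻ r, h r ∂radialMeasure N = ∫⁻ r in Ioi 0, ENNReal.ofReal (N * r ^ (N - 1)) * h r := by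
  rw [radialMeasure, lintegral_withDensity_eq_lintegral_mul _ (by fun_prop) hh]
  rfl

lemma lintegral_exp_neg_rpow_radialMeasure {N : ℕ} (hN : 0 < N) {p : ℝ} (hp : 0 < p) :
    ∫⁻ r, ENNReal.ofReal (Real.exp (-r ^ p)) ∂radialMeasure N =
      ENNReal.ofReal (N * Real.Gamma (N / p) / p) := by
  rw [lintegral_radialMeasure N (by fun_prop)]
  have hq : (-1 : ℝ) < (N : ℝ) - 1 := by
    have : (0 : ℝ) < N := Nat.cast_pos.2 hN
    linarith
  have hint := integral_rpow_mul_exp_neg_rpow hp hq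
  rw [sub_add_cancel] at hint
  have hpos : 0 < 1 / p * Real.Gamma (N / p) :=
    mul_pos (one_div_pos.2 hp) (Real.Gamma_pos_of_pos (div_pos (Nat.cast_pos.2 hN) hp))
  -- A non-integrable function has Bochner integral 0, so the positive value already known forces
  -- integrability.
  have hI : Integrable (fun x : ℝ => x ^ ((N : ℝ) - 1) * Real.exp (-x ^ p))
      (volume.restrict (Ioi 0)) := by
    by_contra h
    rw [integral_undef h] at hint
    exact hpos.ne hint
  have h2 : ∀ r ∈ Ioi (0 : ℝ),
      ENNReal.ofReal (N * r ^ (N - 1)) * ENNReal.ofReal (Real.exp (-r ^ p)) =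
        ENNReal.ofReal (N * (r ^ ((N : ℝ) - 1) * Real.exp (-r ^ p))) := by
    intro r hr
    have hr0 : (0 : ℝ) < r := hr
    rw [← ENNReal.ofReal_mul (by positivity), ← Nat.cast_pred hN, Real.rpow_natCast, mul_assoc]
  rw [setLIntegral_congr_fun measurableSet_Ioi h2, ← ofReal_integral_eq_lintegral_ofReal
    (hI.const_mul _), integral_const_mul, hint]
  · congr 1
    ring
  · filter_upwards [ae_restrict_mem measurableSet_Ioi] with r hr
    have hr0 : (0 : ℝ) < r := hr
    positivity

namespace IsGauge

variable {ι : Type*} [Fintype ι] {F : (ι → ℝ) → ℝ}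

/-- The exponent p is independent of F, so the exponent of a node can also be used for each of its
children. -/
lemma integral_exp_neg_rpow [Nonempty ι] (hF : IsGauge F) {p : ℝ} (hp : 0 < p) :
    ∫ x, Real.exp (-F x ^ p) =
      Fintype.card ι * Real.Gamma (Fintype.card ι / p) / p * (volume {x | F x ≤ 1}).toReal := by
  have hm : Measurable fun x => Real.exp (-F x ^ p) := (hF.measurable.pow_const p).neg.exp
  rw [integral_eq_lintegral_of_nonneg_ae (Eventually.of_forall fun x => (Real.exp_pos _).le)
    hm.aestronglyMeasurable,
    hF.lintegral_comp (h := fun r => ENNReal.ofReal (Real.exp (-r ^ p))) (by fun_prop),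
    lintegral_exp_neg_rpow_radialMeasure Fintype.card_pos hp, ENNReal.toReal_mul,
    ENNReal.toReal_ofReal]
  have := Real.Gamma_nonneg_of_nonneg (s := (Fintype.card ι : ℝ) / p) (by positivity)
  positivity

end IsGauge

/-! ### Volume of the unit ball -/

namespace LpTree

instance (T : LpTree) : Nonempty T.Leaf :=
  Fintype.card_pos_iff.1 (T.card_leaf ▸ T.numLeaves_pos)

lemma isGauge_value (T : LpTree) : IsGauge T.value where
  measurable := T.measurable_value
  smul a ha x := T.value_const_mul ha.le x
  pos x hx := by
    obtain ⟨l, hl⟩ := Function.ne_iff.1 hx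
    exact (abs_pos.2 hl).trans_le (T.abs_le_value x l)
  zero := by
    have h := T.value_const_mul le_rfl (0 : T.Leaf → ℝ)
    rw [zero_mul] at h
    simp only [zero_mul] at h
    exact h
  volume_lt_top := by
    refine (measure_mono (t := Icc (fun _ => -1) fun _ => 1) fun x hx => ?_).trans_lt
      isCompact_Icc.measure_lt_top
    have h := fun l => abs_le.1 ((T.abs_le_value x l).trans hx)
    exact ⟨fun l => (h l).1, fun l => (h l).2⟩

lemma betaFactor_node {m : ℕ} {p : ℝ} (hp : 0 < p) (c : Fin (m + 1) → LpTree) :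
    (node m p hp c).betaFactor = p ^ m * (Real.Gamma (((node m p hp c).numLeaves : ℝ) / p) /
      ∏ i, Real.Gamma ((c i).numLeaves / p)) * ∏ i, (c i).betaFactor := by
  have h := prod_beta_eq (fun i => ((c i).numLeaves : ℝ) / p) fun i =>
    div_pos (Nat.cast_pos.2 (c i).numLeaves_pos) hp
  simp only [← Finset.sum_div, ← Nat.cast_sum] at h
  rw [betaFactor, numLeaves, ← inv_div, ← h, ← Finset.prod_inv_distrib]
  simp only [Nat.cast_sum]

lemma betaFactor_pos (T : LpTree) : 0 < T.betaFactor := by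
  induction T with
  | leaf => exact one_pos
  | node m p hp c ih =>
    rw [betaFactor_node]
    have h : ∀ T : LpTree, 0 < Real.Gamma ((T.numLeaves : ℝ) / p) := fun T =>
      Real.Gamma_pos_of_pos (div_pos (Nat.cast_pos.2 T.numLeaves_pos) hp)
    exact mul_pos (mul_pos (pow_pos hp m) (div_pos (h _) (Finset.prod_pos fun i _ => h _)))
      (Finset.prod_pos fun i _ => ih i)

/-- The p-th power of the value is a sum over disjoint blocks of coordinates, so its exponential is
a product and Fubini applies. -/
lemma integral_exp_neg_value_node {m : ℕ} {p : ℝ} (hp : 0 < p) (c : Fin (m + 1) → LpTree) :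
    ∫ x, Real.exp (-(node m p hp c).value x ^ p) =
      ∏ i, ∫ x, Real.exp (-(c i).value x ^ p) := by
  rw [← integral_fintype_prod_volume_eq_prod]
  refine ((measurePreserving_piCurry_symm (κ := fun i => (c i).Leaf)).integral_comp'
    (fun x => Real.exp (-(node m p hp c).value x ^ p))).symm.trans ?_
  refine integral_congr_ae (Eventually.of_forall fun x => ?_)
  simp only
  rw [← Real.exp_sum, Finset.sum_neg_distrib]
  congr 2
  exact value_node_rpow hp c _

/-- The surface of the unit sphere, written as a multiple of the volume of the unit ball. -/
theorem numLeaves_mul_volume (T : LpTree) :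
    T.numLeaves * (volume {x | T.value x ≤ 1}).toReal = 2 ^ T.numLeaves / T.betaFactor := by
  induction T with
  | leaf =>
    have h : {x : leaf.Leaf → ℝ | leaf.value x ≤ 1} =
        MeasurableEquiv.funUnique Unit ℝ ⁻¹' Icc (-1) 1 := by
      ext x
      exact abs_le (a := x ())
    have hv : volume {x : leaf.Leaf → ℝ | leaf.value x ≤ 1} = volume (Icc (-1 : ℝ) 1) := by
      rw [h]
      exact (volume_preserving_funUnique Unit ℝ).measure_preimage_equiv _
    rw [hv]
    simp [numLeaves, betaFactor]
    norm_num
  | node m p hp c ih =>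
    have h := integral_exp_neg_value_node hp c
    have hΓ : ∀ T : LpTree, 0 < Real.Gamma ((T.numLeaves : ℝ) / p) := fun T =>
      Real.Gamma_pos_of_pos (div_pos (Nat.cast_pos.2 T.numLeaves_pos) hp)
    have key : ∀ T : LpTree, ∫ x, Real.exp (-T.value x ^ p) =
        (T.numLeaves * (volume {x | T.value x ≤ 1}).toReal) *
          Real.Gamma (T.numLeaves / p) / p := fun T => by
      rw [T.isGauge_value.integral_exp_neg_rpow hp, card_leaf]
      ring
    rw [key, Finset.prod_congr rfl fun i _ => key (c i)] at h
    simp only [ih] at h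
    have hN : (∏ i, (2 : ℝ) ^ (c i).numLeaves) = 2 ^ (node m p hp c).numLeaves := by
      rw [Finset.prod_pow_eq_pow_sum]
      rfl
    -- The m + 1 children contribute 1 / p each and the node itself contributes one; the surplus is
    -- the p ^ m of `betaFactor`.
    rw [Finset.prod_div_distrib, Finset.prod_mul_distrib, Finset.prod_div_distrib, hN,
      Finset.prod_const, Finset.card_univ, Fintype.card_fin] at h
    rw [betaFactor_node]
    have h1 := (Finset.prod_pos fun i (_ : i ∈ Finset.univ) => hΓ (c i)).ne'
    have h2 := (Finset.prod_pos fun i (_ : i ∈ Finset.univ) => (c i).betaFactor_pos).ne'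
    have h3 := (hΓ (node m p hp c)).ne'
    have h4 := hp.ne'
    field_simp at h ⊢
    refine mul_left_cancel₀ h4 ?_
    linear_combination h

end LpTree

/-! ### Half-space coordinates -/

namespace LpTree

variable (T : LpTree) {n : ℕ} (e : T.Leaf ≃ Fin (n + 1))

include e in
lemma numLeaves_eq : T.numLeaves = n + 1 := by
  rw [← card_leaf, Fintype.card_congr e, Fintype.card_fin]

lemma measurePreserving_comp_equiv :
    MeasurePreserving (fun (x : Fin (n + 1) → ℝ) l => x (e l)) volume volume := by
  have h := volume_measurePreserving_piCongrLeft (fun _ : T.Leaf => ℝ) e.symm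
  have hfun : (MeasurableEquiv.piCongrLeft (fun _ : T.Leaf => ℝ) e.symm : (Fin (n + 1) → ℝ) → _) =
      fun x l => x (e l) := by
    funext x l
    obtain ⟨i, rfl⟩ := e.symm.surjective l
    rw [MeasurableEquiv.coe_piCongrLeft, Equiv.piCongrLeft_apply_apply, Equiv.apply_symm_apply]
  rwa [hfun] at h

lemma volume_nested_ball_eq :
    volume {x | T.nested e x ≤ 1} = volume {x | T.value x ≤ 1} :=
  (T.measurePreserving_comp_equiv e).measure_preimage (s := {x | T.value x ≤ 1})
    (measurableSet_le T.measurable_value measurable_const).nullMeasurableSet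

lemma isGauge_nested : IsGauge (T.nested e) where
  measurable := T.measurable_value.comp (by fun_prop)
  smul a ha x := T.value_const_mul ha.le _
  pos x hx := T.isGauge_value.pos _ fun h => hx <| by
    funext i
    simpa using congrFun h (e.symm i)
  zero := T.isGauge_value.zero
  volume_lt_top := by
    rw [volume_nested_ball_eq]
    exact T.isGauge_value.volume_lt_top

lemma volume_nested_ball :
    (n + 1) * (volume {x | T.nested e x ≤ 1}).toReal = 2 ^ (n + 1) / T.betaFactor := by
  have h2 := T.numLeaves_mul_volume
  rw [T.numLeaves_eq e] at h2
  rw [volume_nested_ball_eq, ← h2]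
  push_cast
  ring

lemma nested_nonneg (x : Fin (n + 1) → ℝ) : 0 ≤ T.nested e x := T.value_nonneg _

lemma continuous_nested : Continuous (T.nested e) :=
  T.continuous_value.comp (by fun_prop)

lemma abs_le_nested (x : Fin (n + 1) → ℝ) (i : Fin (n + 1)) : |x i| ≤ T.nested e x := by
  have h := T.abs_le_value (fun l => x (e l)) (e.symm i)
  rwa [Equiv.apply_symm_apply] at h

lemma snoc_smul (a : ℝ) (y : Fin n → ℝ) (t : ℝ) :
    (Fin.snoc (a • y) (a * t) : Fin (n + 1) → ℝ) = a • (Fin.snoc y t : Fin (n + 1) → ℝ) := by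
  funext i
  refine Fin.lastCases ?_ (fun i => ?_) i <;> simp

lemma measurable_snoc : Measurable fun q : (Fin n → ℝ) × ℝ =>
    (Fin.snoc q.1 q.2 : Fin (n + 1) → ℝ) := by
  refine measurable_pi_lambda _ fun i => ?_
  refine Fin.lastCases ?_ (fun i => ?_) i
  · simpa using measurable_snd
  · simp only [Fin.snoc_castSucc]
    exact (measurable_pi_apply i).comp measurable_fst

lemma continuous_snoc (y : Fin n → ℝ) : Continuous fun t : ℝ =>
    (Fin.snoc y t : Fin (n + 1) → ℝ) := by
  refine continuous_pi fun i => ?_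
  refine Fin.lastCases ?_ (fun i => ?_) i
  · simpa using continuous_id'
  · simpa using continuous_const

/-- The product of the terms `G_L` at the point of the unit sphere above `u`. -/
def sphereProdG (u : Fin n → ℝ) : ℝ :=
  T.prodG (e.symm (Fin.last n)) (fun l => (Fin.snoc u 0 : Fin (n + 1) → ℝ) (e l)) 1

lemma measurable_sphereProdG : Measurable (T.sphereProdG e) := by
  refine (T.measurable_prodG (e.symm (Fin.last n))).comp (Measurable.prodMk ?_ measurable_const)
  exact measurable_pi_lambda _ fun l => (measurable_pi_apply (e l)).comp
    (measurable_snoc.comp (measurable_id.prodMk (measurable_const (a := (0 : ℝ)))))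

lemma exists_hasDerivAt_nested_snoc (u : Fin n → ℝ) {t : ℝ} (ht : 0 < t) :
    ∃ D : ℝ, 0 < D ∧ HasDerivAt (fun s => T.nested e (Fin.snoc u s)) D t ∧
      (T.nested e (Fin.snoc u t) = 1 → D * T.sphereProdG e u = 1) := by
  obtain ⟨D, hD, h1, h2⟩ := T.exists_hasDerivAt_value (e.symm (Fin.last n))
    (fun l => (Fin.snoc u 0 : Fin (n + 1) → ℝ) (e l))
    (fun s l => (Fin.snoc u s : Fin (n + 1) → ℝ) (e l)) (fun s => by simp)
    (fun s l hl => by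
      obtain ⟨i, rfl⟩ := e.symm.surjective l
      simp only [Equiv.apply_symm_apply]
      induction i using Fin.lastCases with
      | last => exact absurd rfl hl
      | cast i => simp) ht
  refine ⟨D, hD, h1, fun h => ?_⟩
  rw [show T.value (fun l => (Fin.snoc u t : Fin (n + 1) → ℝ) (e l)) = 1 from h,
    Real.one_rpow] at h2
  exact h2

lemma nested_snoc_smul {a : ℝ} (ha : 0 < a) (y : Fin n → ℝ) (t : ℝ) :
    T.nested e (Fin.snoc (a • y) (a * t)) = a * T.nested e (Fin.snoc y t) := by
  rw [snoc_smul, (T.isGauge_nested e).smul a ha]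

/-- The derivative in the last coordinate, at an arbitrary radius. -/
lemma hasDerivAt_nested_snoc (y : Fin n → ℝ) {t : ℝ} (ht : 0 < t) :
    ∃ D : ℝ, 0 < D ∧ HasDerivAt (fun s => T.nested e (Fin.snoc y s)) D t ∧
      D * T.sphereProdG e ((T.nested e (Fin.snoc y t))⁻¹ • y) = 1 := by
  set r := T.nested e (Fin.snoc y t) with hr
  have hr0 : 0 < r := by
    refine lt_of_lt_of_le ht ?_
    simpa using (le_abs_self t).trans
      (by simpa using T.abs_le_nested e (Fin.snoc y t) (Fin.last n))
  -- Rescale to the unit sphere: the derivative of a function homogeneous of degree 1 is homogeneous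
  -- of degree 0, so D is unchanged.
  obtain ⟨D, hD, h1, h2⟩ := T.exists_hasDerivAt_nested_snoc e (r⁻¹ • y)
    (mul_pos (inv_pos.2 hr0) ht)
  refine ⟨D, hD, ?_, h2 ?_⟩
  · have h3 := (h1.comp t ((hasDerivAt_id t).const_mul r⁻¹)).const_mul r
    refine (h3.congr_deriv ?_).congr_of_eventuallyEq (Eventually.of_forall fun s => ?_)
    · field_simp
    · simp only [Function.comp]
      rw [nested_snoc_smul _ _ (inv_pos.2 hr0), mul_inv_cancel_left₀ hr0.ne']
  · rw [nested_snoc_smul _ _ (inv_pos.2 hr0), ← hr, inv_mul_cancel₀ hr0.ne']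

lemma strictMonoOn_nested_snoc (y : Fin n → ℝ) :
    StrictMonoOn (fun t => T.nested e (Fin.snoc y t)) (Ici 0) := by
  refine strictMonoOn_of_deriv_pos (convex_Ici 0)
    ((T.continuous_nested e).comp (continuous_snoc y)).continuousOn fun t ht => ?_
  rw [interior_Ici] at ht
  obtain ⟨D, hD, h, -⟩ := T.hasDerivAt_nested_snoc e y ht
  rwa [h.deriv]

/-- Strict monotonicity gives one inclusion. For the other, f(y, r) ≥ r, so the intermediate value
theorem on [0, r] attains r. -/
lemma image_nested_snoc (y : Fin n → ℝ) :
    (fun t => T.nested e (Fin.snoc y t)) '' Ioi 0 = Ioi (T.nested e (Fin.snoc y 0)) := by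
  have hmono := T.strictMonoOn_nested_snoc e y
  refine Subset.antisymm ?_ fun r hr => ?_
  · rintro _ ⟨t, ht, rfl⟩
    exact hmono self_mem_Ici (mem_Ici.2 (le_of_lt ht)) ht
  · have hr0 : 0 < r := (T.nested_nonneg e _).trans_lt hr
    have hle : r ≤ T.nested e (Fin.snoc y r) := by
      have := T.abs_le_nested e (Fin.snoc y r) (Fin.last n)
      rw [Fin.snoc_last] at this
      exact (le_abs_self r).trans this
    obtain ⟨t, ht, hrt⟩ := intermediate_value_Icc hr0.le
      ((T.continuous_nested e).comp (continuous_snoc y)).continuousOn ⟨le_of_lt hr, hle⟩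
    refine ⟨t, lt_of_le_of_ne ht.1 fun h => ?_, hrt⟩
    subst h
    exact absurd hrt (ne_of_lt hr)

/-- The projection to the first coordinates of the cone measure of a half-shell, up to a constant. -/
def halfDensity (u : Fin n → ℝ) : ℝ≥0∞ :=
  {u | T.nested e (Fin.snoc u 0) < 1}.indicator (fun u => ENNReal.ofReal (T.sphereProdG e u)) u

lemma halfDensity_of_lt {u : Fin n → ℝ} (h : T.nested e (Fin.snoc u 0) < 1) :
    T.halfDensity e u = ENNReal.ofReal (T.sphereProdG e u) :=
  indicator_of_mem (s := {u : Fin n → ℝ | T.nested e (Fin.snoc u 0) < 1}) h _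

lemma halfDensity_of_not_lt {u : Fin n → ℝ} (h : ¬ T.nested e (Fin.snoc u 0) < 1) :
    T.halfDensity e u = 0 :=
  indicator_of_notMem (s := {u : Fin n → ℝ | T.nested e (Fin.snoc u 0) < 1}) h _

lemma measurable_halfDensity : Measurable (T.halfDensity e) := by
  refine (T.measurable_sphereProdG e).ennreal_ofReal.indicator ?_
  exact measurableSet_lt ((T.isGauge_nested e).measurable.comp
    (measurable_snoc.comp (measurable_id.prodMk measurable_const))) measurable_const

/-- One-dimensional substitution `r = f(y, t)`. -/
lemma setLIntegral_nested_snoc (y : Fin n → ℝ) (h : ℝ → ℝ≥0∞) :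
    ∫⁻ t in Ioi 0, h (T.nested e (Fin.snoc y t)) =
      ∫⁻ r in Ioi 0, h r * T.halfDensity e (r⁻¹ • y) := by
  choose! D hD hder hprod using fun t (ht : 0 < t) => T.hasDerivAt_nested_snoc e y ht
  have hsub := lintegral_image_eq_lintegral_abs_deriv_mul measurableSet_Ioi
    (fun t ht => (hder t ht).hasDerivWithinAt)
    ((T.strictMonoOn_nested_snoc e y).mono Ioi_subset_Ici_self).injOn
    (fun r => h r * ENNReal.ofReal (T.sphereProdG e (r⁻¹ • y)))
  rw [image_nested_snoc] at hsub
  have hleft : ∫⁻ r in Ioi 0, h r * T.halfDensity e (r⁻¹ • y) =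
      ∫⁻ r in Ioi (T.nested e (Fin.snoc y 0)),
        h r * ENNReal.ofReal (T.sphereProdG e (r⁻¹ • y)) := by
    rw [← inter_eq_left.2 (Ioi_subset_Ioi (T.nested_nonneg e (Fin.snoc y 0))), ← setLIntegral_indicator measurableSet_Ioi]
    refine setLIntegral_congr_fun measurableSet_Ioi fun r hr => ?_
    have hr0 : (0 : ℝ) < r := hr
    -- By homogeneity, the support of `halfDensity` is exactly the range of r reached by the
    -- substitution.
    have hiff : T.nested e (Fin.snoc (r⁻¹ • y) 0) < 1 ↔ T.nested e (Fin.snoc y 0) < r := by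
      have := T.nested_snoc_smul e (inv_pos.2 hr0) y 0
      rw [mul_zero] at this
      rw [this, inv_mul_lt_iff₀ hr0, mul_one]
    by_cases hlt : T.nested e (Fin.snoc y 0) < r
    · rw [indicator_of_mem (show r ∈ Ioi _ from hlt),
        halfDensity_of_lt _ _ (hiff.2 hlt)]
    · rw [indicator_of_notMem (show r ∉ Ioi _ from hlt),
        halfDensity_of_not_lt _ _ (fun h => hlt (hiff.1 h)), mul_zero]
  rw [hleft, hsub]
  refine setLIntegral_congr_fun measurableSet_Ioi fun t ht => ?_
  have h1 := hprod t ht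
  have h2 := hD t ht
  rw [mul_left_comm, ← ENNReal.ofReal_mul (abs_nonneg _), abs_of_pos h2, h1, ENNReal.ofReal_one,
    mul_one]

lemma lintegral_comp_inv_smul {r : ℝ} (hr : 0 < r) {g : (Fin n → ℝ) → ℝ≥0∞} (hg : Measurable g) :
    ∫⁻ y, g (r⁻¹ • y) = ENNReal.ofReal (r ^ n) * ∫⁻ u, g u := by
  rw [← lintegral_map hg (measurable_const_smul r⁻¹),
    Measure.map_addHaar_smul _ (inv_ne_zero hr.ne'), lintegral_smul_measure]
  simp [abs_of_pos hr]

lemma measurePreserving_snoc :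
    MeasurePreserving (fun q : ℝ × (Fin n → ℝ) => (Fin.snoc q.2 q.1 : Fin (n + 1) → ℝ))
      (volume.prod volume) volume := by
  have h := (volume_preserving_piFinSuccAbove (fun _ : Fin (n + 1) => ℝ) (Fin.last n)).symm
  have hfun : ((MeasurableEquiv.piFinSuccAbove (fun _ : Fin (n + 1) => ℝ) (Fin.last n)).symm :
      ℝ × (Fin n → ℝ) → _) = fun q => Fin.snoc q.2 q.1 := by
    funext q
    exact Fin.insertNth_last' _ _
  rwa [hfun] at h

/-- Integration over a half-space in the coordinates `(x_1 / f(x), …, x_n / f(x), f(x))`. -/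
theorem lintegral_halfSpace {φ : (Fin n → ℝ) → ℝ≥0∞} (hφ : Measurable φ) {η : ℝ → ℝ≥0∞}
    (hη : Measurable η) :
    ∫⁻ x in {x | 0 < x (Fin.last n)}, φ ((T.nested e x)⁻¹ • Fin.init x) * η (T.nested e x) =
      (∫⁻ u, φ u * T.halfDensity e u) * ∫⁻ r in Ioi 0, ENNReal.ofReal (r ^ n) * η r := by
  have hf := (T.isGauge_nested e).measurable
  have hinit : Measurable fun x : Fin (n + 1) → ℝ => (Fin.init x : Fin n → ℝ) :=
    measurable_pi_lambda _ fun i => measurable_pi_apply _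
  have hS : MeasurableSet {x : Fin (n + 1) → ℝ | 0 < x (Fin.last n)} :=
    measurableSet_lt measurable_const (measurable_pi_apply _)
  have hint : Measurable fun x => φ ((T.nested e x)⁻¹ • Fin.init x) * η (T.nested e x) :=
    (hφ.comp (hf.inv.smul hinit)).mul (hη.comp hf)
  rw [← (measurePreserving_snoc (n := n)).setLIntegral_comp_preimage hS hint]
  have hpre : (fun q : ℝ × (Fin n → ℝ) => (Fin.snoc q.2 q.1 : Fin (n + 1) → ℝ)) ⁻¹'
      {x | 0 < x (Fin.last n)} = Ioi 0 ×ˢ univ := by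
    ext q
    simp
  rw [hpre, ← Measure.prod_restrict, Measure.restrict_univ, lintegral_prod_symm]
  swap
  · exact (hint.comp measurePreserving_snoc.measurable).aemeasurable
  simp only [Fin.init_snoc]
  simp_rw [fun y => T.setLIntegral_nested_snoc e y fun r => φ (r⁻¹ • y) * η r]
  have hm : Measurable fun q : (Fin n → ℝ) × ℝ => q.2⁻¹ • q.1 :=
    measurable_snd.inv.smul measurable_fst
  rw [lintegral_lintegral_swap]
  swap
  · exact (((hφ.comp hm).mul (hη.comp measurable_snd)).mul
      ((T.measurable_halfDensity e).comp hm)).aemeasurable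
  have hg : Measurable fun u => φ u * T.halfDensity e u := hφ.mul (T.measurable_halfDensity e)
  rw [← lintegral_const_mul _ (by fun_prop)]
  refine setLIntegral_congr_fun measurableSet_Ioi fun r hr => ?_
  -- For fixed r, the factor r ^ n is the Jacobian of y = r u.
  rw [← mul_assoc, mul_comm (∫⁻ u, _), ← lintegral_comp_inv_smul hr hg, mul_comm,
    ← lintegral_const_mul _ (show Measurable fun y => φ (r⁻¹ • y) * T.halfDensity e (r⁻¹ • y) from
      hg.comp (measurable_const_smul _))]
  refine lintegral_congr fun y => ?_
  ring

end LpTree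

/-! ### The uniform distribution and its projection -/

namespace LpTree

variable (T : LpTree) {n : ℕ} (e : T.Leaf ≃ Fin (n + 1))

lemma normalize_eq : T.normalize e = fun x => (T.nested e x)⁻¹ • x := by
  funext x i
  simp [normalize, div_eq_inv_mul]

lemma measurable_normalize : Measurable (T.normalize e) := by
  rw [normalize_eq]
  exact (T.isGauge_nested e).measurable_normalize

lemma measurableSet_ball : MeasurableSet {x | T.nested e x ≤ 1} :=
  measurableSet_le (T.isGauge_nested e).measurable measurable_const

lemma volume_ball_ne_zero : volume {x | T.nested e x ≤ 1} ≠ 0 :=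
  (T.isGauge_nested e).volume_ball_pos.ne'

lemma volume_ball_ne_top : volume {x | T.nested e x ≤ 1} ≠ ∞ :=
  (T.isGauge_nested e).volume_lt_top.ne

lemma uniformDistribution_eq : T.uniformDistribution e =
    (volume {x | T.nested e x ≤ 1})⁻¹ • IsGauge.coneMeasure (T.nested e) := by
  rw [uniformDistribution, ProbabilityTheory.cond, Measure.map_smul, IsGauge.coneMeasure,
    normalize_eq]

lemma isProbabilityMeasure_uniformDistribution :
    IsProbabilityMeasure (T.uniformDistribution e) := by
  have := ProbabilityTheory.cond_isProbabilityMeasure_of_finite (T.volume_ball_ne_zero e)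
    (T.volume_ball_ne_top e)
  exact Measure.isProbabilityMeasure_map (T.measurable_normalize e).aemeasurable

lemma nested_normalize {x : Fin (n + 1) → ℝ} (hx : x ≠ 0) :
    T.nested e (T.normalize e x) = 1 := by
  have h := (T.isGauge_nested e).pos x hx
  simp only [normalize_eq]
  rw [(T.isGauge_nested e).smul _ (inv_pos.2 h), inv_mul_cancel₀ h.ne']

lemma ae_mem_unitSphere : ∀ᵐ u ∂(T.uniformDistribution e), u ∈ T.unitSphere e := by
  have hS : MeasurableSet (T.unitSphere e) :=
    measurableSet_eq_fun (T.isGauge_nested e).measurable measurable_const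
  refine (ae_map_iff (p := fun u => u ∈ T.unitSphere e)
    (T.measurable_normalize e).aemeasurable hS).2 ?_
  have hne : ∀ᵐ x : Fin (n + 1) → ℝ, x ≠ 0 := compl_mem_ae_iff.2 (measure_singleton 0)
  filter_upwards [ProbabilityTheory.cond_absolutelyContinuous.ae_le hne] with x hx
  exact T.nested_normalize e hx

lemma measurable_init : Measurable fun x : Fin (n + 1) → ℝ => (Fin.init x : Fin n → ℝ) :=
  measurable_pi_lambda _ fun _ => measurable_pi_apply _

lemma measurableSet_pos_last : MeasurableSet {x : Fin (n + 1) → ℝ | 0 < x (Fin.last n)} :=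
  measurableSet_lt measurable_const (measurable_pi_apply _)

lemma lintegral_pow_Iic_one :
    (n + 1) * ∫⁻ r in Ioi 0, ENNReal.ofReal (r ^ n) * (Iic (1 : ℝ)).indicator 1 r = 1 := by
  have h := radialMeasure_Iic n.succ_pos 1
  have h1 : radialMeasure (n + 1) (Iic 1) =
      ∫⁻ r, (Iic (1 : ℝ)).indicator 1 r ∂radialMeasure (n + 1) :=
    (lintegral_indicator_one measurableSet_Iic).symm
  have hi : Measurable ((Iic (1 : ℝ)).indicator (1 : ℝ → ℝ≥0∞)) :=
    measurable_one.indicator measurableSet_Iic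
  rw [h1, lintegral_radialMeasure _ hi] at h
  simp only [zero_le_one, sup_of_le_left, one_pow, ENNReal.ofReal_one] at h
  rw [← lintegral_const_mul _ (show Measurable fun r : ℝ =>
    ENNReal.ofReal (r ^ n) * (Iic (1 : ℝ)).indicator 1 r from
      (by fun_prop : Measurable fun r : ℝ => ENNReal.ofReal (r ^ n)).mul hi)]
  refine (setLIntegral_congr_fun measurableSet_Ioi fun r hr => ?_).trans h
  rw [← mul_assoc, ENNReal.ofReal_mul (by positivity), ENNReal.ofReal_natCast]
  simp

/-- The part of the unit ball above the set `s`, in the open half-space `0 < σ * x_{n + 1}`. -/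
def halfCone (s : Set (Fin n → ℝ)) (σ : ℝ) : Set (Fin (n + 1) → ℝ) :=
  {x | T.nested e x ≤ 1 ∧ (T.nested e x)⁻¹ • (Fin.init x : Fin n → ℝ) ∈ s ∧
    0 < σ * x (Fin.last n)}

/-- This is `lintegral_halfSpace` for the indicators of s and of r ≤ 1; the radial integral of r^n
over (0, 1] is 1 / (n + 1). -/
lemma mul_volume_halfCone_one {s : Set (Fin n → ℝ)} (hs : MeasurableSet s) :
    (n + 1) * volume (T.halfCone e s 1) = ∫⁻ u in s, T.halfDensity e u := by
  have hf := (T.isGauge_nested e).measurable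
  have hA : MeasurableSet {x : Fin (n + 1) → ℝ | T.nested e x ≤ 1 ∧
      (T.nested e x)⁻¹ • (Fin.init x : Fin n → ℝ) ∈ s} :=
    (T.measurableSet_ball e).inter ((hf.inv.smul measurable_init) hs)
  have h := T.lintegral_halfSpace e (φ := s.indicator 1) (measurable_one.indicator hs)
    (η := (Iic 1).indicator 1) (measurable_one.indicator measurableSet_Iic)
  have hl : ∫⁻ x in {x | 0 < x (Fin.last n)}, (s.indicator (1 : (Fin n → ℝ) → ℝ≥0∞)
      ((T.nested e x)⁻¹ • Fin.init x)) * (Iic (1 : ℝ)).indicator 1 (T.nested e x) =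
      volume (T.halfCone e s 1) := by
    have hset : T.halfCone e s 1 = {x : Fin (n + 1) → ℝ | T.nested e x ≤ 1 ∧
        (T.nested e x)⁻¹ • (Fin.init x : Fin n → ℝ) ∈ s} ∩ {x | 0 < x (Fin.last n)} := by
      ext x
      simp [halfCone, and_assoc]
    rw [hset, ← Measure.restrict_apply hA, ← lintegral_indicator_one hA]
    refine lintegral_congr fun x => ?_
    by_cases h1 : (T.nested e x)⁻¹ • (Fin.init x : Fin n → ℝ) ∈ s <;>
      by_cases h2 : T.nested e x ≤ 1 <;> simp [indicator, h1, h2]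
  have hr : ∫⁻ u, s.indicator (1 : (Fin n → ℝ) → ℝ≥0∞) u * T.halfDensity e u =
      ∫⁻ u in s, T.halfDensity e u := by
    rw [← lintegral_indicator hs]
    refine lintegral_congr fun u => ?_
    by_cases hu : u ∈ s <;> simp [hu]
  rw [hl, hr] at h
  rw [h, mul_left_comm, lintegral_pow_Iic_one, mul_one]

/-- The reflection in the last coordinate. -/
def reflectLast (x : Fin (n + 1) → ℝ) : Fin (n + 1) → ℝ :=
  fun i => if i = Fin.last n then -x i else x i

lemma measurePreserving_reflectLast :
    MeasurePreserving (reflectLast (n := n)) volume volume := by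
  refine volume_preserving_pi (f := fun i (t : ℝ) => if i = Fin.last n then -t else t) fun i => ?_
  split_ifs
  · exact Measure.measurePreserving_neg volume
  · exact MeasurePreserving.id volume

/-- Reflection in the last coordinate preserves volume, f and the leading coordinates, and swaps the
two half-spaces. -/
lemma volume_halfCone_neg_one {s : Set (Fin n → ℝ)} (hs : MeasurableSet s) :
    volume (T.halfCone e s (-1)) = volume (T.halfCone e s 1) := by
  have hf := (T.isGauge_nested e).measurable
  have hA : MeasurableSet (T.halfCone e s 1) := by
    refine (T.measurableSet_ball e).inter (((hf.inv.smul measurable_init) hs).inter ?_)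
    exact measurableSet_lt measurable_const (measurable_const.mul (measurable_pi_apply _))
  rw [← measurePreserving_reflectLast.measure_preimage hA.nullMeasurableSet]
  congr 1
  ext x
  have h1 : T.nested e (reflectLast x) = T.nested e x := by
    refine T.value_congr_abs fun l => ?_
    simp only [reflectLast]
    split_ifs <;> simp
  have h2 : (Fin.init (reflectLast x) : Fin n → ℝ) = Fin.init x := by
    funext i
    simp [Fin.init, reflectLast, Fin.castSucc_ne_last]
  have h3 : reflectLast x (Fin.last n) = -x (Fin.last n) := by simp [reflectLast]
  simp only [halfCone, mem_preimage, mem_ofPred_eq, h1, h2, h3]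
  simp

lemma coneMeasure_halfSpace {s : Set (Fin n → ℝ)} (hs : MeasurableSet s) {σ : ℝ} :
    (IsGauge.coneMeasure (T.nested e)) (Fin.init ⁻¹' s ∩ {u | 0 < σ * u (Fin.last n)}) =
      volume (T.halfCone e s σ) := by
  have hm : MeasurableSet (Fin.init ⁻¹' s ∩ {u : Fin (n + 1) → ℝ | 0 < σ * u (Fin.last n)}) :=
    (measurable_init hs).inter
      (measurableSet_lt measurable_const (measurable_const.mul (measurable_pi_apply _)))
  rw [IsGauge.coneMeasure, Measure.map_apply (T.isGauge_nested e).measurable_normalize hm,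
    Measure.restrict_apply ((T.isGauge_nested e).measurable_normalize hm)]
  congr 1
  ext x
  have hiff : 0 < σ * ((T.nested e x)⁻¹ * x (Fin.last n)) ↔ 0 < σ * x (Fin.last n) := by
    rcases eq_or_ne x 0 with rfl | hx
    · simp
    · rw [mul_left_comm]
      exact mul_pos_iff_of_pos_left (inv_pos.2 ((T.isGauge_nested e).pos x hx))
  simp only [halfCone, mem_inter_iff, mem_preimage, mem_ofPred_eq, Pi.smul_apply, smul_eq_mul, hiff]
  have hinit : (Fin.init ((T.nested e x)⁻¹ • x) : Fin n → ℝ) =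
    (T.nested e x)⁻¹ • (Fin.init x : Fin n → ℝ) := rfl
  rw [hinit]
  tauto

/-- With V the volume of the unit ball, (n + 1) V = 2^(n+1) / `betaFactor`: n of the factors 2 form
the denominator of the density and the last one is the halving. -/
lemma ofReal_uniformDensity_half (u : Fin n → ℝ) :
    ENNReal.ofReal (T.uniformDensity e u / 2) =
      (volume {x | T.nested e x ≤ 1})⁻¹ * ((n + 1 : ℝ≥0∞)⁻¹ * T.halfDensity e u) := by
  have hV := T.volume_nested_ball e
  set V := volume {x | T.nested e x ≤ 1} with hVdef
  have hV0 : 0 < V.toReal :=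
    ENNReal.toReal_pos (T.volume_ball_ne_zero e) (T.volume_ball_ne_top e)
  have hc : V⁻¹ * (n + 1 : ℝ≥0∞)⁻¹ = ENNReal.ofReal (V.toReal * (n + 1))⁻¹ := by
    rw [ENNReal.ofReal_inv_of_pos (by positivity), ENNReal.ofReal_mul hV0.le,
      ENNReal.ofReal_toReal (T.volume_ball_ne_top e), ENNReal.mul_inv]
    · congr 2
      rw [ENNReal.ofReal_add (by positivity) zero_le_one]
      simp
    · exact Or.inl (T.volume_ball_ne_zero e)
    · exact Or.inl (T.volume_ball_ne_top e)
  rw [← mul_assoc, hc, mul_comm V.toReal, hV]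
  by_cases h : T.nested e (Fin.snoc u 0) < 1
  · have hb := T.betaFactor_pos
    rw [halfDensity_of_lt _ _ h, ← ENNReal.ofReal_mul (by positivity), uniformDensity, if_pos h]
    congr 1
    change T.sphereProdG e u / 2 ^ n * T.betaFactor / 2 = _
    rw [inv_div, pow_succ]
    field_simp
  · rw [halfDensity_of_not_lt _ _ h, uniformDensity, if_neg h]
    simp

lemma map_init_halfSpace {σ : ℝ} (hσ : σ = 1 ∨ σ = -1) :
    ((T.uniformDistribution e).restrict {u | 0 < σ * u (Fin.last n)}).map Fin.init =
      volume.withDensity (fun u => ENNReal.ofReal (T.uniformDensity e u / 2)) := by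
  ext s hs
  have hvol : (n + 1) * volume (T.halfCone e s σ) = ∫⁻ u in s, T.halfDensity e u := by
    rcases hσ with rfl | rfl
    · exact T.mul_volume_halfCone_one e hs
    · rw [T.volume_halfCone_neg_one e hs, T.mul_volume_halfCone_one e hs]
  rw [Measure.map_apply measurable_init hs, Measure.restrict_apply (measurable_init hs),
    uniformDistribution_eq, Measure.smul_apply, coneMeasure_halfSpace _ _ hs,
    withDensity_apply _ hs]
  simp only [ofReal_uniformDensity_half]
  have hm := T.measurable_halfDensity e
  rw [lintegral_const_mul _ (hm.const_mul _), lintegral_const_mul _ hm, ← hvol, ← mul_assoc _ _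
    (volume (T.halfCone e s σ)), ENNReal.inv_mul_cancel (by simp) (by simp), one_mul, smul_eq_mul]

lemma map_init_pos :
    ((T.uniformDistribution e).restrict {u | 0 < u (Fin.last n)}).map Fin.init =
      volume.withDensity (fun u => ENNReal.ofReal (T.uniformDensity e u / 2)) := by
  simpa only [one_mul] using T.map_init_halfSpace e (Or.inl rfl)

lemma map_init_neg :
    ((T.uniformDistribution e).restrict {u | u (Fin.last n) < 0}).map Fin.init =
      volume.withDensity (fun u => ENNReal.ofReal (T.uniformDensity e u / 2)) := by
  simpa only [neg_mul, one_mul, Left.neg_pos_iff] using T.map_init_halfSpace e (Or.inr rfl)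

lemma uniformDistribution_last_eq_zero :
    T.uniformDistribution e {u | u (Fin.last n) = 0} = 0 := by
  have hm : MeasurableSet {u : Fin (n + 1) → ℝ | u (Fin.last n) = 0} :=
    measurableSet_eq_fun (measurable_pi_apply _) measurable_const
  rw [uniformDistribution, Measure.map_apply (T.measurable_normalize e) hm]
  refine ProbabilityTheory.cond_absolutelyContinuous ?_
  refine measure_mono_null (fun x hx => ?_)
    (Measure.pi_hyperplane (fun _ : Fin (n + 1) => (volume : Measure ℝ)) (Fin.last n) 0)
  have hx' : x (Fin.last n) / T.nested e x = 0 := hx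
  rcases eq_or_ne x 0 with rfl | h0
  · rfl
  · exact (div_eq_zero_iff.1 hx').resolve_right ((T.isGauge_nested e).pos x h0).ne'

lemma map_init :
    (T.uniformDistribution e).map Fin.init =
      volume.withDensity (fun u => ENNReal.ofReal (T.uniformDensity e u)) := by
  have hsplit : (T.uniformDistribution e).restrict {u | 0 < u (Fin.last n)} +
      (T.uniformDistribution e).restrict {u | u (Fin.last n) < 0} = T.uniformDistribution e := by
    have hne : ∀ᵐ u ∂(T.uniformDistribution e), u (Fin.last n) ≠ 0 := by
      rw [ae_iff]
      simpa using T.uniformDistribution_last_eq_zero e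
    have hae : ({u | u (Fin.last n) < 0} : Set (Fin (n + 1) → ℝ)) =ᵐ[T.uniformDistribution e]
        ({u | 0 < u (Fin.last n)}ᶜ : Set (Fin (n + 1) → ℝ)) := by
      filter_upwards [hne] with u hu
      refine propext ⟨fun h => not_lt.2 (le_of_lt h), fun h => ?_⟩
      exact lt_of_le_of_ne (not_lt.1 h) hu
    rw [Measure.restrict_congr_set hae, Measure.restrict_add_restrict_compl measurableSet_pos_last]
  rw [← hsplit, Measure.map_add _ _ measurable_init, map_init_pos, map_init_neg]
  have hm : Measurable fun u => ENNReal.ofReal (T.uniformDensity e u / 2) := by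
    simp only [ofReal_uniformDensity_half]
    exact ((T.measurable_halfDensity e).const_mul _).const_mul _
  rw [← withDensity_add_left hm]
  congr 1
  funext u
  rw [Pi.add_apply]
  -- No sign of the density is needed: where it is nonpositive, `ENNReal.ofReal` truncates it and
  -- its halves to 0.
  rcases le_total 0 (T.uniformDensity e u) with h | h
  · rw [← ENNReal.ofReal_add (by linarith) (by linarith), add_halves]
  · rw [ENNReal.ofReal_of_nonpos h, ENNReal.ofReal_of_nonpos (by linarith), add_zero]

lemma surface_one :
    T.surface e 1 = (n + 1) * (volume {x | T.nested e x ≤ 1}).toReal := by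
  have h : T.ballVolume e =ᶠ[𝓝 1] fun R =>
      R ^ (n + 1) * (volume {x | T.nested e x ≤ 1}).toReal := by
    filter_upwards [lt_mem_nhds one_pos] with R hR
    rw [ballVolume, (T.isGauge_nested e).volume_ball, Fintype.card_fin, max_eq_left hR.le,
      ENNReal.toReal_mul, ENNReal.toReal_ofReal (by positivity)]
  rw [surface, h.deriv_eq, (((hasDerivAt_pow (n + 1) (1 : ℝ)).mul_const _)).deriv]
  simp

/-! ### Symmetric distributions -/

section symmetric

variable {ϱ : ℝ → ℝ} (hϱ : Measurable ϱ)

/-- The law of the radius of a symmetric distribution. -/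
def radialLaw (ϱ : ℝ → ℝ) : Measure ℝ :=
  (volume.restrict (Ioi 0)).withDensity fun r => ENNReal.ofReal (ϱ r)

include hϱ in
-- The weight (n + 1) r^n cancels r^n and the n + 1 in S_f(1) = (n + 1) V, leaving 1 / V, which
-- later normalizes the cone measure.
lemma radialMeasure_withDensity :
    (radialMeasure (n + 1)).withDensity
        (fun r => ENNReal.ofReal (ϱ r / (r ^ n * T.surface e 1))) =
      (volume {x | T.nested e x ≤ 1})⁻¹ • radialLaw ϱ := by
  have hV0 : 0 < (volume {x | T.nested e x ≤ 1}).toReal :=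
    ENNReal.toReal_pos (T.volume_ball_ne_zero e) (T.volume_ball_ne_top e)
  rw [radialLaw, radialMeasure, ← withDensity_mul _ (by fun_prop) (by fun_prop),
    ← withDensity_smul _ (by fun_prop)]
  refine withDensity_congr_ae ?_
  filter_upwards [ae_restrict_mem measurableSet_Ioi] with r hr
  have hr0 : (0 : ℝ) < r := hr
  rw [Pi.mul_apply, Pi.smul_apply, smul_eq_mul, ← ENNReal.ofReal_mul (by positivity), surface_one]
  nth_rw 2 [← ENNReal.ofReal_toReal (T.volume_ball_ne_top e)]
  rw [← ENNReal.ofReal_inv_of_pos hV0, ← ENNReal.ofReal_mul (by positivity)]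
  congr 1
  push_cast [Nat.add_sub_cancel]
  field_simp

include hϱ in
/-- Under a symmetric distribution, the radius and the direction are independent, and the direction
is uniformly distributed. -/
theorem map_symmetricDistribution :
    (T.symmetricDistribution e ϱ).map (fun x => (T.nested e x, T.normalize e x)) =
      (radialLaw ϱ).prod (T.uniformDistribution e) := by
  have hfin := (T.isGauge_nested e).isFiniteMeasure_coneMeasure
  have hf := (T.isGauge_nested e).measurable
  have hpair := hf.prodMk (T.measurable_normalize e)
  have hg : Measurable fun r => ENNReal.ofReal (ϱ r / (r ^ n * T.surface e 1)) := by fun_prop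
  have h1 : (T.symmetricDistribution e ϱ).map (fun x => (T.nested e x, T.normalize e x)) =
      ((radialMeasure (n + 1)).prod (IsGauge.coneMeasure (T.nested e))).withDensity
        fun q => ENNReal.ofReal (ϱ q.1 / (q.1 ^ n * T.surface e 1)) := by
    ext A hA
    have hpol := (T.isGauge_nested e).lintegral_polar
      (h := A.indicator fun q => ENNReal.ofReal (ϱ q.1 / (q.1 ^ n * T.surface e 1)))
      ((hg.comp measurable_fst).indicator hA)
    rw [lintegral_indicator hA, Fintype.card_fin] at hpol
    rw [Measure.map_apply hpair hA, symmetricDistribution, withDensity_apply _ (hpair hA),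
      withDensity_apply _ hA, ← hpol, ← lintegral_indicator (hpair hA)]
    refine lintegral_congr fun x => ?_
    simp only [normalize_eq]
    rfl
  have h2 := prod_withDensity_left (μ := radialMeasure (n + 1))
    (ν := IsGauge.coneMeasure (T.nested e)) hg
  -- The constant 1 / V moves from the directional factor to the radial one.
  rw [h1, uniformDistribution_eq, Measure.prod_smul_right, ← Measure.prod_smul_left,
    ← T.radialMeasure_withDensity e hϱ]
  exact h2.symm

end symmetric

end LpTree

end

theorem proposition3 (T : LpTree) (n : ℕ) (e : T.Leaf ≃ Fin (n + 1)) :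
    -- the uniform distribution is a probability measure carried by the unit sphere
    MeasureTheory.IsProbabilityMeasure (T.uniformDistribution e) ∧
    (∀ᵐ u ∂(T.uniformDistribution e), u ∈ T.unitSphere e) ∧
    -- its density over the first `n` of the `n + 1` coordinates
    (T.uniformDistribution e).map Fin.init =
      MeasureTheory.volume.withDensity (fun u => ENNReal.ofReal (T.uniformDensity e u)) ∧
    -- each of the two half-shells contributes half of this density
    ((T.uniformDistribution e).restrict {u | 0 < u (Fin.last n)}).map Fin.init =
      MeasureTheory.volume.withDensity (fun u => ENNReal.ofReal (T.uniformDensity e u / 2)) ∧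
    ((T.uniformDistribution e).restrict {u | u (Fin.last n) < 0}).map Fin.init =
      MeasureTheory.volume.withDensity (fun u => ENNReal.ofReal (T.uniformDensity e u / 2)) ∧
    -- for each symmetric distribution, radius and direction are independent, with these laws
    ∀ ϱ : ℝ → ℝ, Measurable ϱ → (∀ r, 0 < r → 0 ≤ ϱ r) →
      ∫⁻ r in Set.Ioi (0 : ℝ), ENNReal.ofReal (ϱ r) = 1 →
      MeasureTheory.IsProbabilityMeasure (T.symmetricDistribution e ϱ) ∧
      ProbabilityTheory.IndepFun (T.nested e) (T.normalize e) (T.symmetricDistribution e ϱ) ∧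
      (T.symmetricDistribution e ϱ).map (T.nested e) =
        (MeasureTheory.volume.restrict (Set.Ioi 0)).withDensity (fun r => ENNReal.ofReal (ϱ r)) ∧
      (T.symmetricDistribution e ϱ).map (T.normalize e) = T.uniformDistribution e ∧
      (T.symmetricDistribution e ϱ).map (fun x (i : Fin n) => x i.castSucc / T.nested e x) =
        MeasureTheory.volume.withDensity (fun u => ENNReal.ofReal (T.uniformDensity e u)) := by
  have hprob := T.isProbabilityMeasure_uniformDistribution e
  refine ⟨hprob, T.ae_mem_unitSphere e, T.map_init e, T.map_init_pos e, T.map_init_neg e, ?_⟩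
  intro ϱ hϱ _ hint
  have hrad : MeasureTheory.IsProbabilityMeasure (LpTree.radialLaw ϱ) := ⟨by
    rw [LpTree.radialLaw, MeasureTheory.withDensity_apply _ MeasurableSet.univ,
      MeasureTheory.Measure.restrict_univ, hint]⟩
  have hf := (T.isGauge_nested e).measurable
  have hu := T.measurable_normalize e
  have hmap := T.map_symmetricDistribution e hϱ
  -- Both factors of the joint law are probability measures, so they are its marginals.
  have hfst : (T.symmetricDistribution e ϱ).map (T.nested e) = LpTree.radialLaw ϱ := by
    have h := congrArg (MeasureTheory.Measure.map Prod.fst) hmap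
    rwa [MeasureTheory.Measure.map_map measurable_fst (hf.prodMk hu),
      MeasureTheory.measurePreserving_fst.map_eq] at h
  have hsnd : (T.symmetricDistribution e ϱ).map (T.normalize e) = T.uniformDistribution e := by
    have h := congrArg (MeasureTheory.Measure.map Prod.snd) hmap
    rwa [MeasureTheory.Measure.map_map measurable_snd (hf.prodMk hu),
      MeasureTheory.measurePreserving_snd.map_eq] at h
  have hsym : MeasureTheory.IsProbabilityMeasure (T.symmetricDistribution e ϱ) :=
    ⟨by
      rw [← Set.preimage_univ (f := T.nested e), ← MeasureTheory.Measure.map_apply hf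
        MeasurableSet.univ, hfst]
      exact MeasureTheory.measure_univ⟩
  refine ⟨hsym, ?_, hfst, hsnd, ?_⟩
  · rw [ProbabilityTheory.indepFun_iff_map_prod_eq_prod_map_map hf.aemeasurable hu.aemeasurable,
      hfst, hsnd, hmap]
  · rw [← T.map_init e, ← hsnd, MeasureTheory.Measure.map_map LpTree.measurable_init hu]
    rfl
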